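/- Let $n\ge 0$ and let $R$ be an $n\times n$ integer matrix that is expanding, i.e. all its complex eigenvalues have modulus $>1$. A set $E\subset\mathbb Z^n$ is a complete residue set modulo $R$ if every class of $\mathbb Z^n/R\mathbb Z^n$ contains exactly one element of $E$. A finite set $\mathcal D\subset\mathbb Z^n$ is a skew-product-form digit set with respect to $R$ if $\#\mathcal D=|\det R|$ and there are distinct $a_0,\dots,a_{s-1}\in\mathbb Z^n$ and sets $\mathcal B_0,\dots,\mathcal B_{s-1}\subset\mathbb Z^n$ such that $$\mathcal D=\bigcup_{j=0}^{s-1}\bigl(a_j+R\mathcal B_j\bigr)$$ and, with $\mathcal A=\{a_0,\dots,a_{s-1}\}$, for every $j$ the sum $\mathcal A+\mathcal B_j$ is direct (each of its elements is $a+b$ for a unique pair $(a,b)\in\mathcal A\times\mathcal B_j$) and is a complete residue set modulo $R$. **Theorem.** If $\mathcal D$ is a skew-product-form digit set with respect to $R$, then there is a unique non-empty compact set $T=T(R,\mathcal D)\subset\mathbb R^n$ with $T=\bigcup_{d\in\mathcal D}R^{-1}(T+d)$, and it is a self-affine tile: $T$ has non-empty interior, and there is a discrete set $\mathcal J\subset\mathbb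 R^n$ with $T+\mathcal J=\mathbb R^n$ and $(T+t_1)^\circ\cap(T+t_2)^\circ=\emptyset$ for all distinct $t_1,t_2\in\mathcal J$. -/

import Mathlib

open scoped Pointwise Matrix

namespace SelfAffine

/-- An integer matrix is expanding if all its (complex) eigenvalues have modulus larger than one. -/
def IsExpanding {n : ℕ} (R : Matrix (Fin n) (Fin n) ℤ) : Prop :=
  ∀ z : ℂ, Module.End.HasEigenvalue (Matrix.toLin' (R.map (Int.cast : ℤ → ℂ))) z → 1 < ‖z‖

/-- `E` is a complete residue set modulo `R`: every class of `ℤⁿ / Rℤⁿ` contains exactly one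
element of `E`. -/
def IsCompleteResidueSet {n : ℕ} (R : Matrix (Fin n) (Fin n) ℤ) (E : Set (Fin n → ℤ)) : Prop :=
  ∀ x : Fin n → ℤ, ∃! e, e ∈ E ∧ ∃ y : Fin n → ℤ, x - e = R *ᵥ y

/-- The sum `A + B` is direct: every element of it is `a + b` for a unique pair
`(a, b) ∈ A × B`. -/
def IsDirectSum {n : ℕ} (A B : Set (Fin n → ℤ)) : Prop :=
  Set.InjOn (fun p : (Fin n → ℤ) × (Fin n → ℤ) => p.1 + p.2) (A ×ˢ B)

/-- `D` has skew-product form with respect to `R`: it has `|det R|` elements, and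
`D = ⋃ j, (a j + R (B j))` where, with `A = {a 0, …, a (s - 1)}`, each sum `A + B j` is direct
and is a complete residue set modulo `R`. -/
def IsSkewProductForm {n : ℕ} (R : Matrix (Fin n) (Fin n) ℤ) (D : Finset (Fin n → ℤ)) : Prop :=
  D.card = R.det.natAbs ∧
  ∃ (s : ℕ) (a : Fin s → Fin n → ℤ) (B : Fin s → Set (Fin n → ℤ)),
    Function.Injective a ∧
    (D : Set (Fin n → ℤ)) = ⋃ j, (fun b => a j + R *ᵥ b) '' B j ∧
    ∀ j, IsDirectSum (Set.range a) (B j) ∧ IsCompleteResidueSet R (Set.range a + B j)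

/-- The map `x ↦ R⁻¹ (x + d)` on `ℝⁿ`. -/
noncomputable def digitMap {n : ℕ} (R : Matrix (Fin n) (Fin n) ℤ) (d : Fin n → ℤ)
    (x : Fin n → ℝ) : Fin n → ℝ :=
  (R.map (Int.cast : ℤ → ℝ))⁻¹ *ᵥ (x + fun i => (d i : ℝ))

/-- `T` is a non-empty compact set with `T = ⋃ d ∈ D, R⁻¹ (T + d)`. -/
def IsAttractor {n : ℕ} (R : Matrix (Fin n) (Fin n) ℤ) (D : Finset (Fin n → ℤ))
    (T : Set (Fin n → ℝ)) : Prop :=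
  T.Nonempty ∧ IsCompact T ∧ T = ⋃ d ∈ D, digitMap R d '' T

/-- `T` is a translational tile: for some discrete set `J` the translates `T + t`, `t ∈ J`,
cover `ℝⁿ` and have pairwise disjoint interiors. -/
def IsTranslationalTile {n : ℕ} (T : Set (Fin n → ℝ)) : Prop :=
  ∃ J : Set (Fin n → ℝ), DiscreteTopology J ∧ T + J = Set.univ ∧
    ∀ t₁ ∈ J, ∀ t₂ ∈ J, t₁ ≠ t₂ →
      interior ((fun x => x + t₁) '' T) ∩ interior ((fun x => x + t₂) '' T) = ∅

/-- `T` is the self-affine tile `T(R, D)`: the unique attractor of the maps `x ↦ R⁻¹ (x + d)`,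
`d ∈ D`, with non-empty interior and tiling `ℝⁿ` by translations. -/
structure IsSelfAffineTile {n : ℕ} (R : Matrix (Fin n) (Fin n) ℤ) (D : Finset (Fin n → ℤ))
    (T : Set (Fin n → ℝ)) : Prop where
  isAttractor : IsAttractor R D T
  unique : ∀ T', IsAttractor R D T' → T' = T
  interior_nonempty : (interior T).Nonempty
  isTranslationalTile : IsTranslationalTile T

end SelfAffine

/-! Expansion makes the norms of `R⁻¹ ^ k` summable, so digit series converge to an attractor `T`,
which is unique. Covering is where the skew-product form enters. With `A` the set of the `a j`, the
closed set `Y = A + Rℤⁿ + T` is `Rℤⁿ`-periodic and mapped into itself by `R⁻¹`, which forces `Y =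
ℝⁿ` (`eq_univ_of_periodic_of_invariant`). Hence integer translates of `T` cover space, and Baire
gives interior. For the tiling, `R ^ k T` is a union of at most `|det R| ^ k` integer translates of
`T`. Its volume is `|det R| ^ k` times that of `T`, so these translates cannot overlap. Recentring
such patches at the images of an interior point and taking a limit along an ultrafilter tiles `ℝⁿ`.
-/

namespace SelfAffine

open Filter Topology MeasureTheory

/-! ### Decay of the powers of `R⁻¹`. -/

section Decay

attribute [local instance] Matrix.linftyOpNormedRing Matrix.linftyOpNormedAlgebra

/-- Powers of a complex matrix with all spectral values in the open unit disc are summable in norm. -/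
theorem summable_norm_pow_of_spectrum {n : ℕ} (S : Matrix (Fin n) (Fin n) ℂ)
    (hS : ∀ z ∈ spectrum ℂ S, ‖z‖ < 1) : Summable fun k : ℕ => ‖S ^ k‖ := by
  rcases subsingleton_or_nontrivial (Matrix (Fin n) (Fin n) ℂ) with hsub | hnt
  · have : (fun k : ℕ => ‖S ^ k‖) = fun _ => 0 := by
      funext k
      rw [Subsingleton.elim (S ^ k) 0, norm_zero]
    rw [this]
    exact summable_zero
  have hρ : spectralRadius ℂ S < 1 := by
    refine mod_cast spectrum.spectralRadius_lt_of_forall_lt_of_nonempty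
      (spectrum.nonempty S) (r := 1) fun z hz => ?_
    exact NNReal.coe_lt_coe.1 (hS z hz)
  -- Gelfand's formula: eventually `‖S ^ k‖ ≤ r ^ k` with `r < 1`.
  obtain ⟨r, hr, hr1⟩ := ENNReal.lt_iff_exists_nnreal_btwn.1 hρ
  have hev := (spectrum.pow_nnnorm_pow_one_div_tendsto_nhds_spectralRadius S).eventually_lt_const hr
  have hr1' : (r : ℝ) < 1 := by exact_mod_cast hr1
  refine Summable.of_norm_bounded_eventually_nat (g := fun k => (r : ℝ) ^ k)
    (summable_geometric_of_lt_one r.2 hr1') ?_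
  filter_upwards [hev, eventually_gt_atTop 0] with k hk hk0
  rw [norm_norm]
  have hk' : ((‖S ^ k‖₊ : ENNReal) ^ (1 / k : ℝ)) ^ (k : ℝ) ≤ (r : ENNReal) ^ (k : ℝ) :=
    ENNReal.rpow_le_rpow hk.le (by positivity)
  rw [← ENNReal.rpow_mul, one_div, inv_mul_cancel₀ (by positivity), ENNReal.rpow_one,
    ENNReal.rpow_natCast] at hk'
  exact_mod_cast hk'

theorem exists_summable_bound_pow_mulVec {n : ℕ} (S : Matrix (Fin n) (Fin n) ℝ)
    (hS : ∀ z ∈ spectrum ℂ (S.map ((↑) : ℝ → ℂ)), ‖z‖ < 1) :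
    ∃ c : ℕ → ℝ, Summable c ∧ ∀ k v, ‖S ^ k *ᵥ v‖ ≤ c k * ‖v‖ := by
  refine ⟨_, summable_norm_pow_of_spectrum _ hS, fun k v => ?_⟩
  have h : ‖(S.map ((↑) : ℝ → ℂ)) ^ k‖ = ‖S ^ k‖ := by
    have : (S.map ((↑) : ℝ → ℂ)) ^ k = (S ^ k).map ((↑) : ℝ → ℂ) :=
      (map_pow (Complex.ofRealHom.mapMatrix) S k).symm
    rw [this, Matrix.linfty_opNorm_def, Matrix.linfty_opNorm_def]
    simp
  rw [h]
  exact Matrix.linfty_opNorm_mulVec _ _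

end Decay

/-- The real matrix with the entries of an integer matrix. -/
abbrev realMatrix {n : ℕ} (R : Matrix (Fin n) (Fin n) ℤ) : Matrix (Fin n) (Fin n) ℝ :=
  R.map (Int.cast : ℤ → ℝ)

theorem IsExpanding.det_ne_zero {n : ℕ} {R : Matrix (Fin n) (Fin n) ℤ} (hR : IsExpanding R) :
    R.det ≠ 0 := by
  intro h
  have hdet : (R.map (Int.cast : ℤ → ℂ)).det = 0 := by
    have := (Int.castRingHom ℂ).map_det R
    rw [h, map_zero] at this
    exact this.symm
  obtain ⟨v, hv, hv0⟩ := Matrix.exists_mulVec_eq_zero_iff.2 hdet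
  have := hR 0 (Module.End.hasEigenvalue_of_hasEigenvector (x := v)
    ⟨Module.End.mem_eigenspace_iff.2 (by simpa using hv0), hv⟩)
  norm_num at this

theorem det_realMatrix {n : ℕ} (R : Matrix (Fin n) (Fin n) ℤ) : (realMatrix R).det = R.det :=
  ((Int.castRingHom ℝ).map_det R).symm

theorem IsExpanding.isUnit_det {n : ℕ} {R : Matrix (Fin n) (Fin n) ℤ} (hR : IsExpanding R) :
    IsUnit (realMatrix R).det := by
  rw [det_realMatrix]
  exact isUnit_iff_ne_zero.2 (by exact_mod_cast hR.det_ne_zero)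

/-- The eigenvalues of `R⁻¹` are the inverses of those of `R`. One application of `R⁻¹` may increase
the norm, so the bound concerns all powers. -/
theorem IsExpanding.exists_summable_bound {n : ℕ} {R : Matrix (Fin n) (Fin n) ℤ}
    (hR : IsExpanding R) :
    ∃ c : ℕ → ℝ, Summable c ∧ ∀ k v, ‖(realMatrix R)⁻¹ ^ k *ᵥ v‖ ≤ c k * ‖v‖ := by
  apply exists_summable_bound_pow_mulVec
  intro z hz
  set C : Matrix (Fin n) (Fin n) ℂ := R.map (Int.cast : ℤ → ℂ) with hC
  set S : Matrix (Fin n) (Fin n) ℂ := ((realMatrix R)⁻¹).map ((↑) : ℝ → ℂ) with hSdef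
  have hCS : C * S = 1 := by
    have h1 := congrArg Complex.ofRealHom.mapMatrix (Matrix.mul_nonsing_inv _ hR.isUnit_det)
    rw [map_mul, map_one] at h1
    have h2 : Complex.ofRealHom.mapMatrix (realMatrix R) = C := by
      ext i j
      simp [hC]
    rwa [h2] at h1
  have hSC : S * C = 1 := mul_eq_one_comm.1 hCS
  let u : (Matrix (Fin n) (Fin n) ℂ)ˣ := ⟨C, S, hCS, hSC⟩
  have hz0 : z ≠ 0 := by
    rintro rfl
    exact spectrum.zero_notMem ℂ (u⁻¹).isUnit hz
  have hz' : z⁻¹ ∈ spectrum ℂ C := by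
    have h := spectrum.map_inv (𝕜 := ℂ) u
    have hz2 : z ∈ spectrum ℂ ((u⁻¹ : (Matrix (Fin n) (Fin n) ℂ)ˣ) : Matrix (Fin n) (Fin n) ℂ) := hz
    rw [← h] at hz2
    exact hz2
  have h1 := hR z⁻¹ (Module.End.hasEigenvalue_iff_mem_spectrum.2
    (by rwa [Matrix.spectrum_toLin']))
  rw [norm_inv] at h1
  exact (one_lt_inv₀ (norm_pos_iff.2 hz0)).1 h1

/-! ### The lattice `ℤⁿ` in `ℝⁿ`. -/

variable {n : ℕ}

/-- The inclusion of `ℤⁿ` in `ℝⁿ`. -/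
def intVec (z : Fin n → ℤ) : Fin n → ℝ := fun i => (z i : ℝ)

theorem intVec_add (x y : Fin n → ℤ) : intVec (x + y) = intVec x + intVec y := by
  ext i; simp [intVec]

theorem intVec_sub (x y : Fin n → ℤ) : intVec (x - y) = intVec x - intVec y := by
  ext i; simp [intVec]

theorem intVec_mulVec (R : Matrix (Fin n) (Fin n) ℤ) (x : Fin n → ℤ) :
    intVec (R *ᵥ x) = realMatrix R *ᵥ intVec x := by
  ext i; simp [intVec, Matrix.mulVec, dotProduct]

theorem isClosedEmbedding_intVec : IsClosedEmbedding (intVec (n := n)) :=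
  IsClosedEmbedding.piMap fun _ => Int.isClosedEmbedding_coe_real

theorem exists_norm_sub_intVec_le_one (x : Fin n → ℝ) : ∃ z : Fin n → ℤ, ‖x - intVec z‖ ≤ 1 := by
  refine ⟨fun i => ⌊x i⌋, (pi_norm_le_iff_of_nonneg zero_le_one).2 fun i => ?_⟩
  change ‖x i - ⌊x i⌋‖ ≤ 1
  rw [Int.self_sub_floor, Real.norm_of_nonneg (Int.fract_nonneg _)]
  exact (Int.fract_lt_one _).le

theorem finite_intVec_mem {K : Set (Fin n → ℝ)} (hK : IsCompact K) :
    {z : Fin n → ℤ | intVec z ∈ K}.Finite :=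
  isCompact_iff_finite.1 (isClosedEmbedding_intVec.isCompact_preimage hK)

theorem discreteTopology_image_intVec (J : Set (Fin n → ℤ)) :
    DiscreteTopology (intVec '' J) := by
  have h : IsEmbedding (intVec (n := n) ∘ ((↑) : J → Fin n → ℤ)) :=
    isClosedEmbedding_intVec.isEmbedding.comp .subtypeVal
  have h2 := h.toHomeomorph.symm.isEmbedding.discreteTopology
  rwa [Set.range_comp, Subtype.range_coe] at h2

theorem isClosed_intVec_image_add (P : Set (Fin n → ℤ)) {K : Set (Fin n → ℝ)} (hK : IsCompact K) :
    IsClosed (intVec '' P + K) :=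
  (isClosedEmbedding_intVec.isClosedMap P (isClosed_discrete P)).add_right_of_isCompact hK

/-! ### Existence and uniqueness of the attractor. -/

section Attractor

variable {R : Matrix (Fin n) (Fin n) ℤ} {D : Finset (Fin n → ℤ)}

theorem digitMap_def (R : Matrix (Fin n) (Fin n) ℤ) (d : Fin n → ℤ) (x : Fin n → ℝ) :
    digitMap R d x = (realMatrix R)⁻¹ *ᵥ (x + intVec d) := rfl

theorem tendsto_pow_mulVec_zero {S : Matrix (Fin n) (Fin n) ℝ} {c : ℕ → ℝ} (hc : Summable c)
    (hS : ∀ k v, ‖S ^ k *ᵥ v‖ ≤ c k * ‖v‖) {u : ℕ → Fin n → ℝ} {C : ℝ} (hu : ∀ k, ‖u k‖ ≤ C) :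
    Tendsto (fun k => S ^ k *ᵥ u k) atTop (𝓝 0) := by
  have hC : 0 ≤ C := (norm_nonneg _).trans (hu 0)
  refine squeeze_zero_norm (a := fun k => |c k| * C) (fun k => ?_) ?_
  · calc ‖S ^ k *ᵥ u k‖ ≤ c k * ‖u k‖ := hS k _
      _ ≤ |c k| * C := mul_le_mul (le_abs_self _) (hu k) (norm_nonneg _) (abs_nonneg _)
  · simpa using (hc.tendsto_atTop_zero.abs).mul_const C

/-- Applying the same `k` digit maps to a point of `T` and to `t ∈ T'` gives points whose difference
tends to zero. -/
theorem IsAttractor.subset {T T' : Set (Fin n → ℝ)} (hR : IsExpanding R)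
    (hT : IsAttractor R D T) (hT' : IsAttractor R D T') : T ⊆ T' := by
  obtain ⟨c, hc, hS⟩ := hR.exists_summable_bound
  obtain ⟨-, hcpt, heq⟩ := hT
  obtain ⟨⟨t, ht⟩, hcpt', heq'⟩ := hT'
  have key : ∀ k : ℕ, ∀ x ∈ T, ∃ y ∈ T', ∃ z ∈ T, x - y = (realMatrix R)⁻¹ ^ k *ᵥ (z - t) := by
    intro k
    induction k with
    | zero => exact fun x hx => ⟨t, ht, x, hx, by simp⟩
    | succ k ih =>
      intro x hx
      rw [heq] at hx
      simp only [Set.mem_iUnion] at hx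
      obtain ⟨d, hd, w, hw, rfl⟩ := hx
      obtain ⟨y, hy, z, hz, h⟩ := ih w hw
      refine ⟨digitMap R d y, ?_, z, hz, ?_⟩
      · rw [heq']
        exact Set.mem_biUnion hd (Set.mem_image_of_mem _ hy)
      · rw [digitMap_def, digitMap_def, ← Matrix.mulVec_sub, add_sub_add_right_eq_sub, h,
          Matrix.mulVec_mulVec, pow_succ']
  obtain ⟨C, hC⟩ := hcpt.isBounded.exists_norm_le
  intro x hx
  choose y hy z hz h using fun k => key k x hx
  have h0 := tendsto_pow_mulVec_zero hc hS (u := fun k => z k - t) (C := C + ‖t‖) fun k =>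
    (norm_sub_le _ _).trans (by gcongr; exact hC _ (hz k))
  have h1 : Tendsto y atTop (𝓝 x) := by
    have := (tendsto_const_nhds (x := x)).sub h0
    simpa only [← h, sub_sub_cancel, sub_zero] using this
  exact hcpt'.isClosed.mem_of_tendsto h1 (Eventually.of_forall hy)

/-- The attractor is the continuous image of the compact space `ℕ → D` under `d ↦ ∑ R⁻ᵏ⁻¹ d k`;
splitting off the first digit gives the set equation. -/
theorem exists_isAttractor (hR : IsExpanding R) (hD : D.Nonempty) : ∃ T, IsAttractor R D T := by
  obtain ⟨c, hc, hS⟩ := hR.exists_summable_bound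
  set S := (realMatrix R)⁻¹ with hSdef
  obtain ⟨C, hC⟩ := (D.image intVec).finite_toSet.isBounded.exists_norm_le
  have hCd : ∀ d : D, ‖intVec (d : Fin n → ℤ)‖ ≤ C := fun d =>
    hC _ (by simpa using ⟨d, d.2, rfl⟩)
  obtain ⟨d₀, hd₀⟩ := hD
  let f : ℕ → (ℕ → D) → Fin n → ℝ := fun k d => S ^ (k + 1) *ᵥ intVec (d k : Fin n → ℤ)
  have hsum : Summable fun k => |c (k + 1)| * C :=
    ((summable_nat_add_iff 1).2 hc.abs).mul_right C
  have hbound : ∀ k d, ‖f k d‖ ≤ |c (k + 1)| * C := fun k d =>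
    (hS _ _).trans (mul_le_mul (le_abs_self _) (hCd _) (norm_nonneg _) (abs_nonneg _))
  have hfs : ∀ d, Summable fun k => f k d := fun d =>
    Summable.of_norm_bounded hsum fun k => hbound k d
  have hcont : Continuous fun d => ∑' k, f k d := by
    refine continuous_tsum (fun k => ?_) hsum hbound
    have h1 : Continuous fun d : D => S ^ (k + 1) *ᵥ intVec (d : Fin n → ℤ) :=
      continuous_of_discreteTopology
    exact h1.comp (continuous_apply k)
  have hstep : ∀ d : ℕ → D, ∑' k, f k d =
      digitMap R (d 0) (∑' k, f k fun j => d (j + 1)) := by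
    intro d
    rw [(hfs d).tsum_eq_zero_add, digitMap_def, Matrix.mulVec_add, add_comm]
    congr 1
    · have := (S.mulVecLin.toContinuousLinearMap).map_tsum (hfs fun j => d (j + 1))
      refine Eq.trans ?_ this.symm
      congr 1
      funext k
      simp [f, pow_succ' S (k + 1)]
    · simp [f, hSdef]
  refine ⟨Set.range fun d => ∑' k, f k d, ⟨_, fun _ => ⟨d₀, hd₀⟩, rfl⟩, isCompact_range hcont, ?_⟩
  ext x
  simp only [Set.mem_iUnion]
  constructor
  · rintro ⟨d, rfl⟩
    exact ⟨d 0, (d 0).2, _, ⟨fun j => d (j + 1), rfl⟩, (hstep d).symm⟩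
  · rintro ⟨e, he, _, ⟨d, rfl⟩, rfl⟩
    let d' : ℕ → D
      | 0 => ⟨e, he⟩
      | j + 1 => d j
    exact ⟨d', hstep d'⟩

end Attractor

/-! ### Covering by integer translates, and non-empty interior. -/

section Covering

variable {R : Matrix (Fin n) (Fin n) ℤ} {D : Finset (Fin n → ℤ)} {T : Set (Fin n → ℝ)}

theorem inv_mulVec_mulVec (hR : IsExpanding R) (x : Fin n → ℝ) :
    (realMatrix R)⁻¹ *ᵥ (realMatrix R *ᵥ x) = x := by
  rw [Matrix.mulVec_mulVec, Matrix.nonsing_inv_mul _ hR.isUnit_det, Matrix.one_mulVec]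

theorem mulVec_inv_mulVec (hR : IsExpanding R) (x : Fin n → ℝ) :
    realMatrix R *ᵥ ((realMatrix R)⁻¹ *ᵥ x) = x := by
  rw [Matrix.mulVec_mulVec, Matrix.mul_nonsing_inv _ hR.isUnit_det, Matrix.one_mulVec]

theorem pow_inv_mulVec_pow_mulVec (hR : IsExpanding R) (k : ℕ) (x : Fin n → ℝ) :
    (realMatrix R)⁻¹ ^ k *ᵥ (realMatrix R ^ k *ᵥ x) = x := by
  have hcomm : Commute (realMatrix R)⁻¹ (realMatrix R) := by
    rw [Commute, SemiconjBy, Matrix.nonsing_inv_mul _ hR.isUnit_det,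
      Matrix.mul_nonsing_inv _ hR.isUnit_det]
  rw [Matrix.mulVec_mulVec, ← hcomm.mul_pow, Matrix.nonsing_inv_mul _ hR.isUnit_det, one_pow,
    Matrix.one_mulVec]

theorem pow_mulVec_pow_inv_mulVec (hR : IsExpanding R) (k : ℕ) (x : Fin n → ℝ) :
    realMatrix R ^ k *ᵥ ((realMatrix R)⁻¹ ^ k *ᵥ x) = x := by
  have hcomm : Commute (realMatrix R) (realMatrix R)⁻¹ := by
    rw [Commute, SemiconjBy, Matrix.nonsing_inv_mul _ hR.isUnit_det,
      Matrix.mul_nonsing_inv _ hR.isUnit_det]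
  rw [Matrix.mulVec_mulVec, ← hcomm.mul_pow, Matrix.mul_nonsing_inv _ hR.isUnit_det, one_pow,
    Matrix.one_mulVec]

/-- A closed nonempty set that is invariant under `Rℤⁿ` and mapped into itself by the contraction
`R⁻¹` is the whole space. -/
theorem eq_univ_of_periodic_of_invariant (hR : IsExpanding R) {Y : Set (Fin n → ℝ)}
    (hne : Y.Nonempty) (hcl : IsClosed Y)
    (hper : ∀ y ∈ Y, ∀ w : Fin n → ℤ, y + realMatrix R *ᵥ intVec w ∈ Y)
    (hinv : ∀ y ∈ Y, (realMatrix R)⁻¹ *ᵥ y ∈ Y) : Y = Set.univ := by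
  obtain ⟨c, hc, hS⟩ := hR.exists_summable_bound
  obtain ⟨y₀, hy₀⟩ := hne
  have hpow : ∀ k : ℕ, ∀ y ∈ Y, (realMatrix R)⁻¹ ^ k *ᵥ y ∈ Y := by
    intro k
    induction k with
    | zero => simp
    | succ k ih =>
      intro y hy
      rw [pow_succ', ← Matrix.mulVec_mulVec]
      exact hinv _ (ih y hy)
  refine Set.eq_univ_of_forall fun v => ?_
  -- The approximating point is `R⁻ᵏ⁻¹ (y₀ + R w)`, with `w` a lattice point near `R ^ k v - R⁻¹
  -- y₀`.
  have key : ∀ k : ℕ, ∃ f : Fin n → ℝ, ‖f‖ ≤ 1 ∧ v - (realMatrix R)⁻¹ ^ k *ᵥ f ∈ Y := by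
    intro k
    obtain ⟨w, hw⟩ := exists_norm_sub_intVec_le_one
      (realMatrix R ^ k *ᵥ v - (realMatrix R)⁻¹ *ᵥ y₀)
    refine ⟨_, hw, ?_⟩
    have h := hpow (k + 1) _ (hper y₀ hy₀ w)
    convert h using 1
    rw [pow_succ, ← Matrix.mulVec_mulVec, Matrix.mulVec_add, inv_mulVec_mulVec hR,
      Matrix.mulVec_sub, Matrix.mulVec_sub, Matrix.mulVec_add, pow_inv_mulVec_pow_mulVec hR]
    abel
  choose f hf hfY using key
  have h0 := tendsto_pow_mulVec_zero hc hS hf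
  have h1 := (tendsto_const_nhds (x := v)).sub h0
  rw [sub_zero] at h1
  exact hcl.mem_of_tendsto h1 (Eventually.of_forall hfY)

theorem IsSkewProductForm.nonempty (hR : IsExpanding R) (hD : IsSkewProductForm R D) :
    D.Nonempty := by
  rw [← Finset.card_pos, hD.1]
  exact Int.natAbs_pos.2 hR.det_ne_zero

theorem exists_add_intVec_eq (hR : IsExpanding R) (hD : IsSkewProductForm R D)
    (hT : IsAttractor R D T) (v : Fin n → ℝ) : ∃ z : Fin n → ℤ, v - intVec z ∈ T := by
  have hDne := hD.nonempty hR
  obtain ⟨-, s, a, B, -, hDeq, hB⟩ := hD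
  obtain ⟨⟨t₀, ht₀⟩, hcpt, heq⟩ := hT
  have hTmem : ∀ d ∈ D, ∀ t ∈ T, digitMap R d t ∈ T := fun d hd t ht => by
    rw [heq]
    exact Set.mem_biUnion hd (Set.mem_image_of_mem _ ht)
  have hmem : ∀ j, ∀ b ∈ B j, ∀ t ∈ T,
      intVec b + (realMatrix R)⁻¹ *ᵥ (intVec (a j) + t) ∈ T := by
    intro j b hb t ht
    have hd : a j + R *ᵥ b ∈ D := by
      rw [← Finset.mem_coe, hDeq]
      exact Set.mem_iUnion.2 ⟨j, b, hb, rfl⟩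
    convert hTmem _ hd t ht using 1
    rw [digitMap_def, intVec_add, intVec_mulVec, ← add_assoc,
      Matrix.mulVec_add _ (t + intVec (a j)), inv_mulVec_mulVec hR, add_comm t, add_comm]
  obtain ⟨j₀⟩ : Nonempty (Fin s) := by
    obtain ⟨d, hd⟩ := hDne
    rw [← Finset.mem_coe, hDeq] at hd
    obtain ⟨j, -⟩ := Set.mem_iUnion.1 hd
    exact ⟨j⟩
  have huniv : intVec '' {p | ∃ j z, p = a j + R *ᵥ z} + T = Set.univ := by
    refine eq_univ_of_periodic_of_invariant hR
      ⟨intVec (a j₀ + R *ᵥ 0) + t₀, Set.add_mem_add ⟨_, ⟨j₀, 0, rfl⟩, rfl⟩ ht₀⟩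
      (isClosed_intVec_image_add _ hcpt) ?_ ?_
    · rintro _ ⟨_, ⟨_, ⟨j, z, rfl⟩, rfl⟩, t, ht, rfl⟩ w
      refine ⟨_, ⟨_, ⟨j, z + w, rfl⟩, rfl⟩, t, ht, ?_⟩
      simp only [Matrix.mulVec_add, intVec_add, intVec_mulVec]
      abel
    · rintro _ ⟨_, ⟨_, ⟨j, z, rfl⟩, rfl⟩, t, ht, rfl⟩
      -- Here `R⁻¹ (a j + R z + t) = z + R⁻¹ (a j + t)`. Writing `z = a i + b + R w` with `b ∈ B j`,
      -- the part `b` is absorbed into `T` because `a j + R b` is a digit.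
      obtain ⟨e, ⟨⟨_, ⟨i, rfl⟩, b, hb, rfl⟩, w, hw⟩, -⟩ := (hB j).2 z
      refine ⟨_, ⟨_, ⟨i, w, rfl⟩, rfl⟩, _, hmem j b hb t ht, ?_⟩
      have hz : z = a i + R *ᵥ w + b := by
        rw [← hw]
        simp only
        abel
      have h1 : (realMatrix R)⁻¹ *ᵥ (intVec (a j + R *ᵥ z) + t) =
          intVec z + (realMatrix R)⁻¹ *ᵥ (intVec (a j) + t) := by
        rw [intVec_add, intVec_mulVec, add_right_comm, Matrix.mulVec_add, inv_mulVec_mulVec hR,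
          add_comm]
      simp only
      rw [h1, ← add_assoc, ← intVec_add, ← hz]
  obtain ⟨_, ⟨p, -, rfl⟩, t, ht, rfl⟩ : v ∈ intVec '' {p | ∃ j z, p = a j + R *ᵥ z} + T := by
    rw [huniv]; trivial
  exact ⟨p, by simpa using ht⟩

/-- Baire: countably many closed translates cover `ℝⁿ`. -/
theorem interior_nonempty_of_cover (hcl : IsClosed T)
    (hcov : ∀ v : Fin n → ℝ, ∃ z : Fin n → ℤ, v - intVec z ∈ T) : (interior T).Nonempty := by
  obtain ⟨z, x, hx⟩ := nonempty_interior_of_iUnion_of_closed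
    (f := fun z : Fin n → ℤ => (fun v => v - intVec z) ⁻¹' T)
    (fun z => hcl.preimage (by fun_prop))
    (Set.eq_univ_of_forall fun v => Set.mem_iUnion.2 (hcov v))
  have := preimage_interior_subset_interior_preimage
    (f := fun v => v + intVec z) (t := (fun v => v - intVec z) ⁻¹' T) (by fun_prop)
  refine ⟨x - intVec z, ?_⟩
  have h := this (a := x - intVec z) (by simpa using hx)
  rw [← Set.preimage_comp] at h
  have hid : (fun v => v - intVec z) ∘ (fun v => v + intVec z) = id := by
    funext v; simp
  rwa [hid] at h

end Covering

/-! ### Volume counting and the tiling. -/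

section Volume

theorem disjoint_interior_of_volume {T : Set (Fin n → ℝ)} (hT : IsCompact T)
    {F : Finset (Fin n → ℤ)} {M : ℕ} (hF : F.card ≤ M)
    (hvol : M * volume T ≤ volume (⋃ e ∈ F, (fun x => x + intVec e) '' T))
    {e e' : Fin n → ℤ} (he : e ∈ F) (he' : e' ∈ F) (hne : e ≠ e') :
    interior ((fun x => x + intVec e) '' T) ∩ interior ((fun x => x + intVec e') '' T) = ∅ := by
  set U := interior ((fun x => x + intVec e) '' T) ∩ interior ((fun x => x + intVec e') '' T)
    with hU
  by_contra hUne
  have hUo : IsOpen U := isOpen_interior.inter isOpen_interior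
  have hUpos : 0 < volume U := hUo.measure_pos _ (Set.nonempty_iff_ne_empty.2 hUne)
  have hvt : ∀ e : Fin n → ℤ, volume ((fun x => x + intVec e) '' T) = volume T := fun e => by
    rw [Set.image_add_right, measure_preimage_add_right]
  have hfin : volume T ≠ ⊤ := hT.measure_ne_top
  have hUsub : U ⊆ (fun x => x + intVec e') '' T := fun x hx => interior_subset hx.2
  have hUle : volume U ≤ volume T := (measure_mono hUsub).trans_eq (hvt e')
  -- The overlap `U` already lies in the copy at `e`, so it can be removed from the copy at `e'`,
  -- which makes the union too small.
  have hsub : (⋃ e ∈ F, (fun x => x + intVec e) '' T) ⊆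
      (⋃ e ∈ F.erase e', (fun x => x + intVec e) '' T) ∪ ((fun x => x + intVec e') '' T \ U) := by
    intro x hx
    obtain ⟨d, hd, hx⟩ := Set.mem_iUnion₂.1 hx
    by_cases hde : d = e'
    · subst hde
      by_cases hxU : x ∈ U
      · exact Or.inl (Set.mem_iUnion₂.2 ⟨e, Finset.mem_erase.2 ⟨hne, he⟩, interior_subset hxU.1⟩)
      · exact Or.inr ⟨hx, hxU⟩
    · exact Or.inl (Set.mem_iUnion₂.2 ⟨d, Finset.mem_erase.2 ⟨hde, hd⟩, hx⟩)
  have h1 : volume (⋃ e ∈ F.erase e', (fun x => x + intVec e) '' T) ≤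
      (F.card - 1 : ℕ) * volume T := by
    refine (measure_biUnion_finset_le _ _).trans_eq ?_
    rw [Finset.sum_congr rfl fun e _ => hvt e, Finset.sum_const, Finset.card_erase_of_mem he',
      nsmul_eq_mul]
  have h2 : volume ((fun x => x + intVec e') '' T \ U) < volume T := by
    rw [measure_sdiff hUsub hUo.measurableSet.nullMeasurableSet (ne_top_of_le_ne_top hfin hUle), hvt]
    exact ENNReal.sub_lt_self hfin (hUpos.trans_le hUle).ne' hUpos.ne'
  have hpos : 0 < F.card := Finset.card_pos.2 ⟨e, he⟩
  have h3 : volume (⋃ e ∈ F, (fun x => x + intVec e) '' T) < M * volume T :=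
    calc _ ≤ volume (⋃ e ∈ F.erase e', (fun x => x + intVec e) '' T) +
          volume ((fun x => x + intVec e') '' T \ U) :=
        (measure_mono hsub).trans (measure_union_le _ _)
      _ < (F.card - 1 : ℕ) * volume T + volume T :=
        ENNReal.add_lt_add_of_le_of_lt
          (ne_top_of_le_ne_top (ENNReal.mul_ne_top (by simp) hfin) h1) h1 h2
      _ = (F.card : ℕ) * volume T := by
        nth_rewrite 2 [← Nat.sub_add_cancel hpos]
        push_cast
        ring
      _ ≤ M * volume T := by gcongr
  exact (h3.trans_le hvol).false

variable {R : Matrix (Fin n) (Fin n) ℤ} {D : Finset (Fin n → ℤ)} {T : Set (Fin n → ℝ)}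

/-- Iterates `R T = T + D`. Only an upper bound on the cardinality is claimed, since different digit
strings might give the same translate. -/
theorem IsAttractor.exists_level_digits (hR : IsExpanding R) (hT : IsAttractor R D T) (k : ℕ) :
    ∃ F : Finset (Fin n → ℤ), F.card ≤ D.card ^ k ∧
      (fun x => realMatrix R ^ k *ᵥ x) '' T = ⋃ e ∈ F, (fun x => x + intVec e) '' T := by
  classical
  induction k with
  | zero =>
    refine ⟨{0}, by simp, ?_⟩
    have h0 : intVec (0 : Fin n → ℤ) = 0 := by ext; simp [intVec]
    simp [h0]
  | succ k ih =>
    obtain ⟨F, hF, hFT⟩ := ih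
    refine ⟨(D ×ˢ F).image fun p => p.1 + R *ᵥ p.2, ?_, ?_⟩
    · refine Finset.card_image_le.trans ?_
      rw [Finset.card_product, pow_succ']
      gcongr
    · have h1 : (fun x => realMatrix R ^ (k + 1) *ᵥ x) '' T =
          (fun x => realMatrix R *ᵥ x) '' ((fun x => realMatrix R ^ k *ᵥ x) '' T) := by
        rw [Set.image_image]
        simp only [Matrix.mulVec_mulVec, pow_succ']
      rw [h1, hFT]
      ext x
      simp only [Set.mem_image, Set.mem_iUnion, Finset.mem_image, Finset.mem_product, Prod.exists]
      constructor
      · rintro ⟨_, ⟨e, he, t, ht, rfl⟩, rfl⟩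
        rw [hT.2.2] at ht
        simp only [Set.mem_iUnion] at ht
        obtain ⟨d, hd, t', ht', rfl⟩ := ht
        refine ⟨_, ⟨d, e, ⟨hd, he⟩, rfl⟩, t', ht', ?_⟩
        rw [Matrix.mulVec_add, digitMap_def, mulVec_inv_mulVec hR, intVec_add, intVec_mulVec,
          add_assoc]
      · rintro ⟨_, ⟨d, e, ⟨hd, he⟩, rfl⟩, t, ht, rfl⟩
        refine ⟨_, ⟨e, he, digitMap R d t, ?_, rfl⟩, ?_⟩
        · rw [hT.2.2]
          exact Set.mem_biUnion hd (Set.mem_image_of_mem _ ht)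
        · rw [Matrix.mulVec_add, digitMap_def, mulVec_inv_mulVec hR, intVec_add, intVec_mulVec,
            add_assoc]

theorem volume_pow_mulVec_image (R : Matrix (Fin n) (Fin n) ℤ) (T : Set (Fin n → ℝ)) (k : ℕ) :
    volume ((fun x => realMatrix R ^ k *ᵥ x) '' T) = (R.det.natAbs ^ k : ℕ) * volume T := by
  have h := Measure.addHaar_image_linearMap volume (Matrix.toLin' (realMatrix R ^ k)) T
  rw [LinearMap.det_toLin', Matrix.det_pow, det_realMatrix] at h
  have h2 : ENNReal.ofReal |(R.det : ℝ) ^ k| = (R.det.natAbs ^ k : ℕ) := by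
    rw [abs_pow, ← Int.cast_abs, ← Nat.cast_natAbs, ← Nat.cast_pow, ENNReal.ofReal_natCast]
  rw [h2] at h
  exact h

theorem IsAttractor.isTranslationalTile (hR : IsExpanding R) (hD : D.card = R.det.natAbs)
    (hT : IsAttractor R D T) (hint : (interior T).Nonempty) : IsTranslationalTile T := by
  obtain ⟨c, hc, hS⟩ := hR.exists_summable_bound
  choose F hF hFT using hT.exists_level_digits hR
  obtain ⟨x, hx⟩ := hint
  choose w hw using fun k : ℕ => exists_norm_sub_intVec_le_one (realMatrix R ^ k *ᵥ x)
  have hle : (hyperfilter ℕ : Filter ℕ) ≤ atTop := Nat.hyperfilter_le_atTop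
  have htrans : ∀ z : Fin n → ℤ, ∀ y : Fin n → ℝ, y ∈ (fun x => x + intVec z) '' T ↔
      y - intVec z ∈ T := fun z y => by
    rw [Set.image_add_right, Set.mem_preimage, sub_eq_add_neg]
  -- The patch `F k`, shifted by `-w k`, covers ever larger regions around the origin; the
  -- ultrafilter selects a limit without choosing subsequences.
  refine ⟨intVec '' {z | ∀ᶠ k in hyperfilter ℕ, z + w k ∈ F k}, discreteTopology_image_intVec _,
    Set.eq_univ_of_forall fun v => ?_, ?_⟩
  · have hlim : Tendsto (fun k => (realMatrix R)⁻¹ ^ k *ᵥ (v + intVec (w k))) atTop (𝓝 x) := by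
      have h0 := tendsto_pow_mulVec_zero hc hS
        (u := fun k => v - (realMatrix R ^ k *ᵥ x - intVec (w k))) (C := ‖v‖ + 1)
        fun k => (norm_sub_le _ _).trans (by gcongr; exact hw k)
      have h1 := h0.add_const x
      rw [zero_add] at h1
      refine h1.congr fun k => ?_
      rw [sub_sub_eq_add_sub, Matrix.mulVec_sub, pow_inv_mulVec_pow_mulVec hR, sub_add_cancel]
    -- Only finitely many `z` satisfy `v - z ∈ T`, so the ultrafilter settles on a single one.
    have hev : ∀ᶠ k in hyperfilter ℕ,
        ∃ z ∈ {z : Fin n → ℤ | intVec z ∈ (fun t => v - t) '' T}, z + w k ∈ F k := by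
      refine Filter.Eventually.filter_mono hle ?_
      filter_upwards [hlim (isOpen_interior.mem_nhds hx)] with k hk
      have hk' : v + intVec (w k) ∈ (fun x => realMatrix R ^ k *ᵥ x) '' T :=
        ⟨_, interior_subset hk, pow_mulVec_pow_inv_mulVec hR k _⟩
      rw [hFT k] at hk'
      obtain ⟨e, he, hve⟩ := Set.mem_iUnion₂.1 hk'
      rw [htrans] at hve
      refine ⟨e - w k, ⟨_, hve, ?_⟩, by simpa using he⟩
      simp only [intVec_sub]
      abel
    have hfin := finite_intVec_mem (hT.2.1.image (f := fun t => v - t) (by fun_prop))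
    obtain ⟨z, ⟨t, ht, htz⟩, hz⟩ := (Ultrafilter.eventually_exists_mem_iff hfin).1 hev
    exact ⟨t, ht, _, ⟨z, hz, rfl⟩, by simp [← htz]⟩
  · rintro _ ⟨z, hz, rfl⟩ _ ⟨z', hz', rfl⟩ hne
    -- Both translates occur in one common patch, where volume excludes overlap.
    obtain ⟨k, hk, hk'⟩ := (hz.and hz').exists
    have hdis := disjoint_interior_of_volume hT.2.1 (hF k)
      (by rw [← hFT k, volume_pow_mulVec_image, hD]) hk hk'
      (fun h => hne (congrArg intVec (add_right_cancel h)))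
    have hshift : ∀ z : Fin n → ℤ, interior ((fun x => x + intVec (z + w k)) '' T) =
        (fun x => x + intVec (w k)) '' interior ((fun x => x + intVec z) '' T) := by
      intro z
      have h := (Homeomorph.addRight (intVec (w k))).image_interior ((fun x => x + intVec z) '' T)
      rw [Set.image_image] at h
      simp only [Homeomorph.coe_addRight, add_assoc, ← intVec_add] at h
      exact h.symm
    rw [hshift, hshift, ← Set.image_inter (add_left_injective _), Set.image_eq_empty] at hdis
    exact hdis

end Volume

end SelfAffine

theorem theorem1p2 (n : ℕ) (R : Matrix (Fin n) (Fin n) ℤ) (hR : SelfAffine.IsExpanding R)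
    (D : Finset (Fin n → ℤ)) (hD : SelfAffine.IsSkewProductForm R D) :
    ∃ T : Set (Fin n → ℝ), SelfAffine.IsSelfAffineTile R D T := by
  obtain ⟨T, hT⟩ := SelfAffine.exists_isAttractor hR (hD.nonempty hR)
  have hint := SelfAffine.interior_nonempty_of_cover hT.2.1.isClosed
    (SelfAffine.exists_add_intVec_eq hR hD hT)
  exact ⟨T, hT, fun T' hT' => (SelfAffine.IsAttractor.subset hR hT' hT).antisymm
    (SelfAffine.IsAttractor.subset hR hT hT'), hint, hT.isTranslationalTile hR hD.1 hint⟩
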